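/- Let $\Omega=\{-1,+1\}^{\mathbb Z^2}$, let $\Lambda_n=[-n,n]^2\cap\mathbb Z^2$ and $M_n(\sigma)=\frac1{|\Lambda_n|}\sum_{i\in\Lambda_n}\sigma_i$. Let $\beta\in\mathbb R$, and consider the infinite-volume continuous-time heat-bath Glauber dynamics of the nearest-neighbour Ising model on $\mathbb Z^2$ at inverse temperature $\beta$ and zero external field, constructed through the Harris graphical representation: the sites carry independent rate-one Poisson clocks, and when the clock at $i$ rings, the spin at $i$ is resampled, independently of everything else, to be $+1$ with probability $e^{\beta h}/(e^{\beta h}+e^{-\beta h})$ and $-1$ otherwise, where $h=\sum_{j\sim i}\sigma_j$ is the sum of the four neighbouring spins just before the ring. For $\xi\in\Omega$, let $\mathbb P_\xi$ be the law on the path space $D([0,\infty),\Omega)$ of the dynamics $(\sigma_t)_{t\ge0}$ started from $\sigma_0=\xi$, and let $P_t(\xi,\cdot)$ be the law of $\sigma_t$ under $\mathbb P_\xi$. For $r\in[-1,1]$, set $$C_r=\{\sigma\in\Omega: M_n(\sigma)\to r\},\qquad D_r=\{\xi\in C_r: P_t(\xi,C_r)=1\ \text{for every } t\ge0\},$$ $$S_{C_r}=\{\xi\in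 C_r: \mathbb P_\xi(\sigma_t\in C_r\ \text{for all } t\ge0)=1\},$$ where the last probability refers to the completion of $\mathbb P_\xi$ (it is part of the definition of $S_{C_r}$ that the complement of the event is contained in a measurable $\mathbb P_\xi$-null set). Then, for every $r\in[-1,1]$, $$D_r\subset S_{C_r}.$$ -/

import Mathlib

open MeasureTheory ProbabilityTheory Filter Topology
open scoped NNReal

/-! ### Configurations and magnetization levels -/

/-- Sites of the square lattice `ℤ²`. -/
abbrev Site : Type := ℤ × ℤ

/-- The configuration space `Ω = {-1,+1}^{ℤ²}`, with the product topology and the product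
σ-algebra. -/
abbrev Config : Type := Site → ℤˣ

instance instMeasurableSingletonClassSpin : MeasurableSingletonClass ℤˣ where
  measurableSet_singleton a := by
    refine ⟨{(a : ℤ)}, measurableSet_singleton _, ?_⟩
    ext b
    simp [Units.ext_iff]

/-- The box `Λ_n = [-n,n]² ∩ ℤ²`. -/
noncomputable def box (n : ℕ) : Finset Site :=
  Finset.Icc (-(n : ℤ)) (n : ℤ) ×ˢ Finset.Icc (-(n : ℤ)) (n : ℤ)

/-- The block magnetization `M_n(σ) = |Λ_n|⁻¹ ∑_{i ∈ Λ_n} σ_i`. -/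
noncomputable def magnetization (n : ℕ) (σ : Config) : ℝ :=
  (1 / ((box n).card : ℝ)) * ∑ i ∈ box n, ((σ i : ℤ) : ℝ)

/-- The exact magnetization level `C_r = {σ : M_n(σ) → r}`. -/
def level (r : ℝ) : Set Config :=
  {σ | Tendsto (fun n => magnetization n σ) atTop (𝓝 r)}

/-! ### The Harris noise: rate-one clocks with uniform marks -/

/-- A realization of the noise: for every site `i` and every `k`, the waiting time before the
`k`-th ring (counted from `0`) of the clock at `i`, and the uniform mark attached to that ring. -/
abbrev Noise : Type := Site × ℕ → ℝ × unitInterval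

instance instIsProbabilityMeasureExpOne : IsProbabilityMeasure (expMeasure 1) :=
  isProbabilityMeasure_expMeasure one_pos

/-- The law of the noise: all waiting times are exponential of rate `1`, all marks are uniform
on `[0,1]`, and everything is independent.  Hence the clocks are independent Poisson processes
of rate `1`. -/
noncomputable def noiseMeasure : Measure Noise :=
  Measure.infinitePi fun _ : Site × ℕ => (expMeasure 1).prod (volume : Measure unitInterval)

/-- Time of the `k`-th ring (counted from `0`) at site `i`. -/
noncomputable def ringTime (ω : Noise) (i : Site) (k : ℕ) : ℝ :=
  ∑ m ∈ Finset.range (k + 1), (ω (i, m)).1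

/-- Uniform mark of the `k`-th ring at site `i`. -/
noncomputable def mark (ω : Noise) (i : Site) (k : ℕ) : ℝ := ((ω (i, k)).2 : ℝ)

/-- The waiting times are positive and no clock rings infinitely often in a bounded time.
This holds almost surely. -/
def Noise.IsRegular (ω : Noise) : Prop :=
  ∀ i : Site, (∀ k : ℕ, 0 < (ω (i, k)).1) ∧ Tendsto (ringTime ω i) atTop atTop

/-- Number of rings at `i` in `[0,t]`: the index of the first ring after time `t`. -/
noncomputable def ringsUpTo (ω : Noise) (i : Site) (t : ℝ) : ℕ := sInf {k | t < ringTime ω i k}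

/-- Number of rings at `i` in `[0,t)`: the index of the first ring not before time `t`. -/
noncomputable def ringsBefore (ω : Noise) (i : Site) (t : ℝ) : ℕ := sInf {k | t ≤ ringTime ω i k}

/-! ### Heat-bath dynamics through the graphical representation -/

/-- The four nearest neighbours of a site. -/
def neighbors (i : Site) : Finset Site :=
  {(i.1 + 1, i.2), (i.1 - 1, i.2), (i.1, i.2 + 1), (i.1, i.2 - 1)}

/-- The field `∑_{j ∼ i} σ_j` felt at site `i`. -/
def localField (σ : Config) (i : Site) : ℤ := ∑ j ∈ neighbors i, (σ j : ℤ)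

/-- The heat-bath probability of a plus spin at inverse temperature `β` and zero external field,
given the sum `h` of the neighbouring spins. -/
noncomputable def plusProb (β : ℝ) (h : ℤ) : ℝ :=
  Real.exp (β * h) / (Real.exp (β * h) + Real.exp (-(β * h)))

/-- The heat-bath update of the spin at `i`, driven by the uniform variable `u`. -/
noncomputable def heatBath (β : ℝ) (u : ℝ) (σ : Config) (i : Site) : ℤˣ :=
  if u < plusProb β (localField σ i) then 1 else -1

/-- The spin at `i` just after its first `k` rings, computed backwards in time with a recursion
of depth at most `d` (when the depth is exhausted, the initial spin is returned).  Before the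
first ring it is the initial spin; the `k`-th ring (counted from `0`) replaces it by the
heat-bath update that uses the mark of this ring and the neighbouring spins just before it. -/
noncomputable def spinAtDepth (β : ℝ) (ξ : Config) (ω : Noise) : ℕ → Site → ℕ → ℤˣ
  | _, i, 0 => ξ i
  | 0, i, _ + 1 => ξ i
  | d + 1, i, k + 1 =>
      heatBath β (mark ω i k)
        (fun j => spinAtDepth β ξ ω d j (ringsBefore ω j (ringTime ω i k))) i

open Classical in
/-- The spin at `i` just after its first `k` rings.  Almost surely, only finitely many rings can
be reached from a given ring by going backwards in time along neighbouring sites, so that the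
recursion `spinAtDepth` does not depend on the depth, once it is large enough. -/
noncomputable def spinAfter (β : ℝ) (ξ : Config) (ω : Noise) (i : Site) (k : ℕ) : ℤˣ :=
  if ∀ᶠ d in atTop, spinAtDepth β ξ ω d i k = 1 then 1 else -1

/-- The configuration `σ_t` started from `ξ` and driven by the noise `ω`. -/
noncomputable def graphicalConfig (β : ℝ) (ξ : Config) (ω : Noise) (t : ℝ≥0) : Config :=
  fun i => spinAfter β ξ ω i (ringsUpTo ω i t)

/-- Right-continuous with left limits. -/
def IsCadlag (f : ℝ≥0 → Config) : Prop :=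
  ∀ t, ContinuousWithinAt f (Set.Ici t) t ∧ ∃ l, Tendsto f (𝓝[<] t) (𝓝 l)

/-- The path space `D([0,∞), Ω)`, with the σ-algebra generated by the evaluations (which is the
Borel σ-algebra of the Skorokhod topology). -/
abbrev PathSpace : Type := {f : ℝ≥0 → Config // IsCadlag f}

theorem isCadlag_const (ξ : Config) : IsCadlag fun _ => ξ :=
  fun _ => ⟨continuousWithinAt_const, ξ, tendsto_const_nhds⟩

theorem isCadlag_graphicalConfig (β : ℝ) (ξ : Config) {ω : Noise} (hω : ω.IsRegular) :
    IsCadlag (graphicalConfig β ξ ω) := by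
  have hne : ∀ (i : Site) (t : ℝ), ∃ k, t < ringTime ω i k := fun i t =>
    ((hω i).2.eventually (eventually_gt_atTop t)).exists
  intro t
  constructor
  · refine tendsto_pi_nhds.2 fun i => ?_
    refine tendsto_const_nhds.congr' ?_
    have hn : (t : ℝ) < ringTime ω i (ringsUpTo ω i t) := Nat.sInf_mem (hne i t)
    have h1 : ∀ᶠ s : ℝ≥0 in 𝓝[≥] t, (s : ℝ) < ringTime ω i (ringsUpTo ω i t) :=
      (NNReal.continuous_coe.continuousAt.eventually_lt continuousAt_const hn).filter_mono
        nhdsWithin_le_nhds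
    filter_upwards [h1, self_mem_nhdsWithin] with s hs hts
    have : ringsUpTo ω i s = ringsUpTo ω i t := by
      refine le_antisymm (Nat.sInf_le hs) (Nat.sInf_le ?_)
      have h2 : (s : ℝ) < ringTime ω i (ringsUpTo ω i s) := Nat.sInf_mem (hne i s)
      exact lt_of_le_of_lt (NNReal.coe_le_coe.2 hts) h2
    simp [graphicalConfig, this]
  · refine ⟨fun i => spinAfter β ξ ω i (ringsBefore ω i t), tendsto_pi_nhds.2 fun i => ?_⟩
    refine tendsto_const_nhds.congr' ?_
    have hne' : ∃ k, (t : ℝ) ≤ ringTime ω i k := (hne i t).imp fun _ h => h.le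
    have h1 : ∀ᶠ s : ℝ≥0 in 𝓝[<] t, ∀ m ∈ Finset.range (ringsBefore ω i t),
        ringTime ω i m < s := by
      rw [Filter.eventually_all_finset]
      intro m hm
      have hm' : ringTime ω i m < t := by
        by_contra h
        exact Nat.notMem_of_lt_sInf (Finset.mem_range.1 hm) (not_lt.1 h)
      exact (continuousAt_const.eventually_lt NNReal.continuous_coe.continuousAt hm').filter_mono
        nhdsWithin_le_nhds
    filter_upwards [h1, self_mem_nhdsWithin] with s hs hst
    have h3 : (t : ℝ) ≤ ringTime ω i (ringsBefore ω i t) := Nat.sInf_mem hne'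
    have : ringsUpTo ω i s = ringsBefore ω i t := by
      refine le_antisymm (Nat.sInf_le (lt_of_lt_of_le (NNReal.coe_lt_coe.2 hst) h3)) ?_
      by_contra h
      have h4 := hs _ (Finset.mem_range.2 (not_le.1 h))
      have h5 : (s : ℝ) < ringTime ω i (ringsUpTo ω i s) := Nat.sInf_mem (hne i s)
      exact lt_asymm h4 h5
    simp [graphicalConfig, this]

open Classical in
/-- The trajectory `t ↦ σ_t` started from `ξ` and driven by the noise `ω`, as a point of the path
space (constant on the null set of irregular noises). -/
noncomputable def graphicalPath (β : ℝ) (ξ : Config) (ω : Noise) : PathSpace :=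
  if hω : ω.IsRegular then ⟨graphicalConfig β ξ ω, isCadlag_graphicalConfig β ξ hω⟩
  else ⟨fun _ => ξ, isCadlag_const ξ⟩

theorem measurable_ringTime (i : Site) (k : ℕ) : Measurable fun ω : Noise => ringTime ω i k := by
  unfold ringTime
  fun_prop

theorem measurable_mark (i : Site) (k : ℕ) : Measurable fun ω : Noise => mark ω i k := by
  unfold mark
  exact measurable_subtype_coe.comp (measurable_snd.comp (measurable_pi_apply _))

theorem measurableSet_isRegular : MeasurableSet {ω : Noise | ω.IsRegular} := by
  have : {ω : Noise | ω.IsRegular} = ⋂ i : Site, (⋂ k : ℕ, {ω : Noise | 0 < (ω (i, k)).1}) ∩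
      {ω : Noise | Tendsto (fun k => ringTime ω i k) atTop atTop} := by
    ext ω
    simp [Noise.IsRegular]
  rw [this]
  refine MeasurableSet.iInter fun i => MeasurableSet.inter (MeasurableSet.iInter fun k => ?_) ?_
  · exact measurableSet_lt measurable_const (measurable_fst.comp (measurable_pi_apply _))
  · exact measurableSet_tendsto _ fun k => measurable_ringTime i k

theorem measurable_sInf_nat {α : Type*} [MeasurableSpace α] {p : α → ℕ → Prop}
    (hp : ∀ k, MeasurableSet {a | p a k}) : Measurable fun a => sInf {k | p a k} := by
  classical
  refine measurable_to_countable' fun n => ?_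
  have : (fun a => sInf {k | p a k}) ⁻¹' {n} =
      {a | (p a n ∧ ∀ m < n, ¬ p a m) ∨ (n = 0 ∧ ∀ m, ¬ p a m)} := by
    ext a
    simp only [Set.mem_preimage, Set.mem_singleton_iff, Set.mem_ofPred_eq]
    constructor
    · rintro rfl
      by_cases h : ∃ k, p a k
      · exact Or.inl ⟨Nat.sInf_mem h, fun m hm => Nat.notMem_of_lt_sInf hm⟩
      · push Not at h
        exact Or.inr ⟨by simp [h], h⟩
    · rintro (⟨h1, h2⟩ | ⟨rfl, h⟩)
      · refine le_antisymm (Nat.sInf_le h1) ?_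
        by_contra hlt
        exact h2 _ (not_le.1 hlt) (Nat.sInf_mem ⟨n, h1⟩)
      · simp [h]
  rw [this]
  refine ((hp n).inter ?_).union ((MeasurableSet.const _).inter ?_)
  · have : {a | ∀ m < n, ¬ p a m} = ⋂ m, ⋂ (_ : m < n), {a | p a m}ᶜ := by ext; simp
    change MeasurableSet {a | ∀ m < n, ¬ p a m}
    rw [this]
    exact MeasurableSet.iInter fun m => MeasurableSet.iInter fun _ => (hp m).compl
  · have : {a | ∀ m, ¬ p a m} = ⋂ m, {a | p a m}ᶜ := by ext; simp
    change MeasurableSet {a | ∀ m, ¬ p a m}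
    rw [this]
    exact MeasurableSet.iInter fun m => (hp m).compl

theorem measurable_heatBath (β : ℝ) (i : Site) :
    Measurable fun x : ℝ × Config => heatBath β x.1 x.2 i := by
  have h : Measurable fun x : ℝ × Config => localField x.2 i := by
    unfold localField
    exact Finset.measurable_fun_sum _ fun j _ => (measurable_of_countable fun s : ℤˣ => (s : ℤ)).comp
      ((measurable_pi_apply j).comp measurable_snd)
  exact Measurable.ite (measurableSet_lt measurable_fst
    ((measurable_of_countable (plusProb β)).comp h)) measurable_const measurable_const

theorem measurable_comp_nat {α γ : Type*} [MeasurableSpace α] [MeasurableSpace γ]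
    {f : α → ℕ → γ} {N : α → ℕ} (hf : ∀ k, Measurable fun a => f a k) (hN : Measurable N) :
    Measurable fun a => f a (N a) :=
  (measurable_from_prod_countable_left (f := fun x : α × ℕ => f x.1 x.2) hf).comp
    (measurable_id.prodMk hN)

theorem measurable_spinAtDepth (β : ℝ) (ξ : Config) (d : ℕ) (i : Site) (k : ℕ) :
    Measurable fun ω : Noise => spinAtDepth β ξ ω d i k := by
  induction d generalizing i k with
  | zero => cases k <;> simp [spinAtDepth]
  | succ d ih =>
    cases k with
    | zero => simp [spinAtDepth]
    | succ k =>
      simp only [spinAtDepth]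
      refine (measurable_heatBath β i).comp ((measurable_mark i k).prodMk
        (measurable_pi_lambda _ fun j => measurable_comp_nat (fun m => ih j m) ?_))
      exact measurable_sInf_nat fun m =>
        measurableSet_le (measurable_ringTime i k) (measurable_ringTime j m)

theorem measurable_spinAfter (β : ℝ) (ξ : Config) (i : Site) (k : ℕ) :
    Measurable fun ω : Noise => spinAfter β ξ ω i k := by
  classical
  unfold spinAfter
  refine Measurable.ite ?_ measurable_const measurable_const
  have : {ω : Noise | ∀ᶠ d in atTop, spinAtDepth β ξ ω d i k = 1} =
      ⋃ D : ℕ, ⋂ d : ℕ, ⋂ (_ : D ≤ d), {ω : Noise | spinAtDepth β ξ ω d i k = 1} := by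
    ext ω
    simp [eventually_atTop]
  rw [this]
  exact MeasurableSet.iUnion fun D => MeasurableSet.iInter fun d => MeasurableSet.iInter fun _ =>
    measurable_spinAtDepth β ξ d i k (measurableSet_singleton 1)

theorem measurable_graphicalPath (β : ℝ) (ξ : Config) : Measurable (graphicalPath β ξ) := by
  classical
  refine Measurable.subtype_mk (f := fun ω => (graphicalPath β ξ ω).1) ?_
  refine measurable_pi_lambda _ fun t => measurable_pi_lambda _ fun i => ?_
  have : (fun ω => (graphicalPath β ξ ω).1 t i) =
      fun ω => if ω.IsRegular then spinAfter β ξ ω i (ringsUpTo ω i t) else ξ i := by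
    funext ω
    unfold graphicalPath
    split_ifs <;> rfl
  rw [this]
  refine Measurable.ite measurableSet_isRegular ?_ measurable_const
  exact measurable_comp_nat (fun k => measurable_spinAfter β ξ i k)
    (measurable_sInf_nat fun m => measurableSet_lt measurable_const (measurable_ringTime i m))

/-- The law `ℙ_ξ`, on the path space, of the heat-bath Glauber dynamics started from `ξ`. -/
noncomputable def pathLaw (β : ℝ) (ξ : Config) : Measure PathSpace :=
  noiseMeasure.map (graphicalPath β ξ)

instance instIsProbabilityMeasurePathLaw (β : ℝ) (ξ : Config) :
    IsProbabilityMeasure (pathLaw β ξ) := by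
  unfold pathLaw noiseMeasure
  exact Measure.isProbabilityMeasure_map (measurable_graphicalPath β ξ).aemeasurable

/-- The transition probability `P_t(ξ, ·)`: the law of `σ_t` under `ℙ_ξ`. -/
noncomputable def transition (β : ℝ) (t : ℝ≥0) (ξ : Config) : Measure Config :=
  (pathLaw β ξ).map fun γ => γ.1 t

/-! ### Confinement sets -/

/-- The deterministic-time confinement set `{ξ ∈ C : P_t(ξ, C) = 1 for every t ≥ 0}`. -/
def fixedTimeConfined (β : ℝ) (C : Set Config) : Set Config :=
  {ξ | ξ ∈ C ∧ ∀ t : ℝ≥0, transition β t ξ C = 1}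

/-- The pathwise confinement set `{ξ ∈ C : ℙ_ξ(σ_t ∈ C for all t ≥ 0) = 1}`.  The path event need
not lie in the evaluation σ-algebra; `∀ᵐ` says that its complement is contained in a measurable
null set, that is, that the event has probability one for the completed law. -/
def pathwiseConfined (β : ℝ) (C : Set Config) : Set Config :=
  {ξ | ξ ∈ C ∧ ∀ᵐ γ ∂(pathLaw β ξ), ∀ t : ℝ≥0, γ.1 t ∈ C}

/-! ### Local pieces of the noise -/

/-! A spin can change only when its own clock rings, and the clocks of different sites are
independent even though the spins interact. Fix a time `s`. The probability that a given clock rings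
within `δ` of `s` tends to `0` with `δ`, because ring times have no atoms and do not accumulate. By
the law of large numbers, almost surely the fraction of sites of `Λ_n` that ring in this window is
below `ε` for all large `n`. Hence `M_n(σ_t)` and `M_n(σ_s)` differ by at most `2ε` for all such
`n`, simultaneously for every `t` in the window.

For each `ε = 1/(q+1)`, countably many such windows cover `[0,∞)`, and at their centres the path
lies in `C_r` almost surely by the fixed-time hypothesis. A single null set therefore serves all
times. The main ingredients are `tendsto_siteNoiseMeasure_ringsNear`, `ae_eventually_boxAverage_lt`,
`eq_of_notMem_movesNear` and `exists_countable_cover_ringsNear_lt`. -/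

/-- The clock data at a single site. -/
abbrev SiteNoise : Type := ℕ → ℝ × unitInterval

/-- The law of the clock data at a single site. -/
noncomputable def siteNoiseMeasure : Measure SiteNoise :=
  Measure.infinitePi fun _ : ℕ => (expMeasure 1).prod (volume : Measure unitInterval)

/-- The clock data at the site `i`. -/
def siteNoise (ω : Noise) (i : Site) : SiteNoise := fun k => ω (i, k)

instance : IsProbabilityMeasure siteNoiseMeasure := by
  unfold siteNoiseMeasure; infer_instance

instance : IsProbabilityMeasure noiseMeasure := by
  unfold noiseMeasure; infer_instance

theorem measurable_siteNoise (i : Site) : Measurable fun ω : Noise => siteNoise ω i := by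
  unfold siteNoise; fun_prop

theorem map_siteNoise (i : Site) :
    noiseMeasure.map (fun ω => siteNoise ω i) = siteNoiseMeasure :=
  Measure.map_infinitePi_infinitePi_of_inj (f := fun k : ℕ => (i, k))
    (P := fun _ : Site × ℕ => (expMeasure 1).prod (volume : Measure unitInterval))
    (Prod.mk_right_injective i)

theorem iIndepFun_siteNoise : iIndepFun (fun i ω => siteNoise ω i) noiseMeasure := by
  rw [iIndepFun_iff_map_fun_eq_infinitePi_map measurable_siteNoise]
  simp_rw [map_siteNoise]
  exact Measure.infinitePi_map_curry (ι := Site) (κ := ℕ)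
    fun _ _ => (expMeasure 1).prod (volume : Measure unitInterval)

/-- Time of the `k`-th ring of a single clock. -/
noncomputable def siteRingTime (w : SiteNoise) (k : ℕ) : ℝ :=
  ∑ m ∈ Finset.range (k + 1), (w m).1

theorem measurable_siteRingTime (k : ℕ) : Measurable fun w => siteRingTime w k := by
  unfold siteRingTime; fun_prop

instance : NullSingletonClass (expMeasure 1) := by
  unfold expMeasure gammaMeasure; infer_instance

/-- Fubini: once `X` is fixed, `Y` must take a single value, which its atomless law does not charge.
-/
theorem measure_add_eq_zero_of_indepFun {Ω : Type*} [MeasurableSpace Ω] {μ : Measure Ω}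
    [IsProbabilityMeasure μ] {X Y : Ω → ℝ} (hX : Measurable X) (hY : Measurable Y)
    (hXY : IndepFun X Y μ) [NullSingletonClass (μ.map Y)] (s : ℝ) : μ {a | X a + Y a = s} = 0 := by
  have := Measure.isProbabilityMeasure_map (μ := μ) hX.aemeasurable
  have := Measure.isProbabilityMeasure_map (μ := μ) hY.aemeasurable
  have hm : MeasurableSet {p : ℝ × ℝ | p.1 + p.2 = s} :=
    measurableSet_eq_fun (by fun_prop) measurable_const
  have h1 : μ {a | X a + Y a = s} = μ.map (fun a => (X a, Y a)) {p | p.1 + p.2 = s} := by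
    rw [Measure.map_apply (hX.prodMk hY) hm]; rfl
  rw [h1, hXY.map_prod_eq_prod_map_map hX.aemeasurable hY.aemeasurable,
    Measure.measure_prod_null hm]
  refine ae_of_all _ fun x => ?_
  have : Prod.mk x ⁻¹' {p : ℝ × ℝ | p.1 + p.2 = s} = {s - x} := by
    ext y
    simp [eq_sub_iff_add_eq, add_comm]
  change μ.map Y (Prod.mk x ⁻¹' {p : ℝ × ℝ | p.1 + p.2 = s}) = 0
  rw [this]
  exact measure_singleton _

theorem siteNoiseMeasure_siteRingTime_eq (k : ℕ) (s : ℝ) :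
    siteNoiseMeasure {w | siteRingTime w k = s} = 0 := by
  have hind : iIndepFun (fun (m : ℕ) (w : SiteNoise) => (w m).1) siteNoiseMeasure :=
    iIndepFun_infinitePi (P := fun _ : ℕ => (expMeasure 1).prod (volume : Measure unitInterval))
      (X := fun _ x => x.1) fun _ => measurable_fst
  have hmeas : ∀ m, Measurable fun w : SiteNoise => (w m).1 := fun m => by fun_prop
  have hlaw : siteNoiseMeasure.map (fun w : SiteNoise => (w k).1) = expMeasure 1 := by
    have h : siteNoiseMeasure.map (fun w : SiteNoise => w k) =
        (expMeasure 1).prod (volume : Measure unitInterval) :=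
      Measure.infinitePi_map_eval
        (fun _ : ℕ => (expMeasure 1).prod (volume : Measure unitInterval)) k
    have h2 := Measure.map_map (μ := siteNoiseMeasure) (g := Prod.fst) measurable_fst
      (measurable_pi_apply (X := fun _ : ℕ => ℝ × unitInterval) k)
    rw [h] at h2
    refine h2.symm.trans ?_
    simp [Measure.map_fst_prod]
  have hna : NullSingletonClass (siteNoiseMeasure.map fun w : SiteNoise => (w k).1) := by
    rw [hlaw]; infer_instance
  -- The last waiting time, which is atomless, is split off from the independent sum of the earlier
  -- ones.
  have hsum := hind.indepFun_finsetSum_of_notMem hmeas (s := Finset.range k) (i := k) (by simp)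
  have := measure_add_eq_zero_of_indepFun
    ((Finset.range k).measurable_sum fun m _ => hmeas m) (hmeas k)
    (by simpa [Finset.sum_fn] using hsum) s
  simpa [siteRingTime, Finset.sum_range_succ] using this

/-- The event that a non-explosive clock rings at distance less than `δ` from time `s`. -/
def ringsNear (s δ : ℝ) : Set SiteNoise :=
  {w | Tendsto (siteRingTime w) atTop atTop ∧ ∃ k, |siteRingTime w k - s| < δ}

theorem measurableSet_ringsNear (s δ : ℝ) : MeasurableSet (ringsNear s δ) := by
  refine MeasurableSet.inter (measurableSet_tendsto _ measurable_siteRingTime) ?_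
  have : {w | ∃ k, |siteRingTime w k - s| < δ} = ⋃ k, {w | |siteRingTime w k - s| < δ} := by
    ext; simp
  change MeasurableSet {w | ∃ k, |siteRingTime w k - s| < δ}
  rw [this]
  exact MeasurableSet.iUnion fun k => measurableSet_lt
    (continuous_abs.measurable.comp ((measurable_siteRingTime k).sub measurable_const))
    measurable_const

/-- By continuity from above it suffices that the intersection is null. Non-explosion, built into
`ringsNear`, leaves finitely many rings close to `s`; if none occurs exactly at `s`, they stay at a
positive distance. -/
theorem tendsto_siteNoiseMeasure_ringsNear (s : ℝ) :
    Tendsto (fun n : ℕ => siteNoiseMeasure (ringsNear s (1 / ((n : ℝ) + 1)))) atTop (𝓝 0) := by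
  have hanti : Antitone fun n : ℕ => ringsNear s (1 / ((n : ℝ) + 1)) := fun m n hmn w hw =>
    ⟨hw.1, hw.2.imp fun k hk => hk.trans_le (one_div_le_one_div_of_le (by positivity)
      (by exact_mod_cast Nat.succ_le_succ hmn))⟩
  have h := tendsto_measure_iInter_atTop (μ := siteNoiseMeasure)
    (fun n : ℕ => (measurableSet_ringsNear s (1 / ((n : ℝ) + 1))).nullMeasurableSet) hanti
    ⟨0, measure_ne_top _ _⟩
  have h0 : siteNoiseMeasure (⋂ n : ℕ, ringsNear s (1 / ((n : ℝ) + 1))) = 0 := by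
    refine measure_mono_null (t := ⋃ k, {w | siteRingTime w k = s}) (fun w hw => ?_)
      (measure_iUnion_null fun k => siteNoiseMeasure_siteRingTime_eq k s)
    rw [Set.mem_iInter] at hw
    by_contra hne
    simp only [Set.mem_iUnion, Set.mem_ofPred_eq, not_exists] at hne
    -- All radii are at most `1`, so rings after `s + 1` are irrelevant and only indices below `K`
    -- matter.
    obtain ⟨K, hK⟩ := eventually_atTop.1 ((hw 0).1.eventually (eventually_ge_atTop (s + 1)))
    have hpos : ∀ᶠ n : ℕ in atTop, ∀ k ∈ Finset.range K,
        1 / ((n : ℝ) + 1) < |siteRingTime w k - s| := by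
      rw [eventually_all_finset]
      exact fun k _ => tendsto_one_div_add_atTop_nhds_zero_nat.eventually
        (gt_mem_nhds (abs_pos.2 (sub_ne_zero.2 (hne k))))
    obtain ⟨n, hn⟩ := hpos.exists
    obtain ⟨k, hk⟩ := (hw n).2
    rcases lt_or_ge k K with hkK | hkK
    · exact lt_asymm hk (hn k (Finset.mem_range.2 hkK))
    · have h1 := hK k hkK
      have h2 : 1 / ((n : ℝ) + 1) ≤ 1 := by
        rw [div_le_one (by positivity)]
        linarith [Nat.cast_nonneg (α := ℝ) n]
      linarith [(abs_lt.1 hk).2]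
  rwa [h0] at h

theorem exists_siteNoiseMeasure_ringsNear_lt (s : ℝ) {ε : ℝ} (hε : 0 < ε) :
    ∃ δ > 0, siteNoiseMeasure.real (ringsNear s δ) < ε := by
  have h := (tendsto_siteNoiseMeasure_ringsNear s).eventually
    (gt_mem_nhds (ENNReal.ofReal_pos.2 hε))
  obtain ⟨n, hn⟩ := h.exists
  exact ⟨1 / ((n : ℝ) + 1), by positivity,
    (ENNReal.lt_ofReal_iff_toReal_lt (measure_ne_top _ _)).1 hn⟩

/-! ### A law of large numbers along boxes -/

theorem card_box (n : ℕ) : (box n).card = (2 * n + 1) ^ 2 := by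
  simp only [box, Finset.card_product, Int.card_Icc]
  rw [sq, show ((n : ℤ) + 1 - -n).toNat = 2 * n + 1 by omega]

/-- The average over the box `Λ_n`. -/
noncomputable def boxAverage (n : ℕ) (f : Site → ℝ) : ℝ :=
  (1 / ((box n).card : ℝ)) * ∑ i ∈ box n, f i

theorem boxAverage_mono (n : ℕ) {f g : Site → ℝ} (h : ∀ i, f i ≤ g i) :
    boxAverage n f ≤ boxAverage n g :=
  mul_le_mul_of_nonneg_left (Finset.sum_le_sum fun i _ => h i) (by positivity)

/-- Chebyshev and Borel–Cantelli: `|Λ_n|` grows quadratically, so second moments already give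
summable bounds and pairwise independence suffices. -/
theorem ae_eventually_boxAverage_lt {Ω : Type*} [MeasurableSpace Ω] {μ : Measure Ω}
    [IsProbabilityMeasure μ] {X : Site → Ω → ℝ} (hX : ∀ i, Measurable (X i))
    (hbd : ∀ i a, X i a ∈ Set.Icc (0 : ℝ) 1) (hind : Pairwise fun i j => IndepFun (X i) (X j) μ)
    {p ε : ℝ} (hp : ∀ i, ∫ a, X i a ∂μ ≤ p) (hε : 0 < ε) :
    ∀ᵐ a ∂μ, ∀ᶠ n in atTop, boxAverage n (fun i => X i a) < p + ε := by
  have hL : ∀ i, MemLp (X i) 2 μ := fun i =>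
    MemLp.of_bound (hX i).aestronglyMeasurable 1 (ae_of_all _ fun a => by
      rw [Real.norm_eq_abs, abs_of_nonneg (hbd i a).1]; exact (hbd i a).2)
  have hcard : ∀ n, 0 < ((box n).card : ℝ) := fun n => by
    rw [card_box]; positivity
  have hcheb : ∀ n, μ {a | p + ε ≤ boxAverage n (fun i => X i a)} ≤
      ENNReal.ofReal (1 / ε ^ 2 * (1 / ((n : ℝ) + 1) ^ 2)) := by
    intro n
    have hc := hcard n
    have hS : MemLp (∑ i ∈ box n, X i) 2 μ := memLp_finsetSum' _ fun i _ => hL i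
    have hvar : variance (∑ i ∈ box n, X i) μ ≤ (box n).card := by
      rw [IndepFun.variance_sum (fun i _ => hL i) fun i _ j _ hij => hind hij]
      refine (Finset.sum_le_card_nsmul _ _ 1 fun i _ => ?_).trans (by simp)
      refine (variance_le_sq_of_bounded (ae_of_all _ (hbd i)) (hX i).aemeasurable).trans ?_
      norm_num
    have hmean : ∫ a, (∑ i ∈ box n, X i) a ∂μ ≤ (box n).card * p := by
      simp only [Finset.sum_apply]
      rw [integral_finsetSum _ fun i _ => (hL i).integrable (by norm_num)]
      exact (Finset.sum_le_card_nsmul _ _ p fun i _ => hp i).trans (by simp)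
    have hle := meas_ge_le_variance_div_sq hS (mul_pos hc hε)
    refine (measure_mono fun a ha => ?_).trans (hle.trans (ENNReal.ofReal_le_ofReal ?_))
    · have ha' : (p + ε) * (box n).card ≤ ∑ i ∈ box n, X i a := by
        have : p + ε ≤ (∑ i ∈ box n, X i a) / (box n).card := by
          simpa [boxAverage, div_eq_inv_mul] using ha
        rwa [le_div_iff₀ hc] at this
      change _ ≤ |(∑ i ∈ box n, X i) a - ∫ a, (∑ i ∈ box n, X i) a ∂μ|
      refine le_trans ?_ (le_abs_self _)
      rw [Finset.sum_apply]
      linarith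
    · calc variance (∑ i ∈ box n, X i) μ / ((box n).card * ε) ^ 2
          ≤ (box n).card / ((box n).card * ε) ^ 2 := by gcongr
        _ = 1 / ε ^ 2 * (1 / (box n).card) := by field_simp
        _ ≤ 1 / ε ^ 2 * (1 / ((n : ℝ) + 1) ^ 2) := by
          rw [card_box]
          push_cast
          gcongr
          have := Nat.cast_nonneg (α := ℝ) n
          linarith
  have hsum : Summable fun n : ℕ => 1 / ε ^ 2 * (1 / ((n : ℝ) + 1) ^ 2) := by
    refine Summable.mul_left _ ?_
    have h := (summable_nat_add_iff (G := ℝ) 1).2 (Real.summable_one_div_nat_pow.2 one_lt_two)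
    simpa using h
  have hfin : ∑' n, μ {a | p + ε ≤ boxAverage n (fun i => X i a)} ≠ ⊤ := by
    refine ne_top_of_le_ne_top ?_ (ENNReal.tsum_le_tsum hcheb)
    exact hsum.tsum_ofReal_ne_top
  filter_upwards [ae_eventually_notMem hfin] with a ha
  filter_upwards [ha] with n hn
  exact not_le.1 hn

theorem ae_eventually_boxAverage_ringsNear_lt {s δ ε : ℝ}
    (h : siteNoiseMeasure.real (ringsNear s δ) < ε) :
    ∀ᵐ ω ∂noiseMeasure, ∀ᶠ n in atTop,
      boxAverage n (fun i => (ringsNear s δ).indicator 1 (siteNoise ω i)) < ε := by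
  have hA := measurableSet_ringsNear s δ
  have hm : Measurable ((ringsNear s δ).indicator (1 : SiteNoise → ℝ)) :=
    measurable_one.indicator hA
  have key := ae_eventually_boxAverage_lt (μ := noiseMeasure)
    (X := fun i ω => (ringsNear s δ).indicator (1 : SiteNoise → ℝ) (siteNoise ω i))
    (fun i => hm.comp (measurable_siteNoise i))
    (fun i ω => ⟨Set.indicator_nonneg (fun _ _ => zero_le_one) _,
      Set.indicator_le_self' (fun _ _ => zero_le_one) _⟩)
    (fun i j hij => (iIndepFun_siteNoise.comp (fun _ => _) fun _ => hm).indepFun hij)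
    (p := siteNoiseMeasure.real (ringsNear s δ))
    (fun i => by
      rw [← integral_indicator_one hA, ← map_siteNoise i,
        integral_map (measurable_siteNoise i).aemeasurable hm.aestronglyMeasurable])
    -- The tolerance is the gap between the mean and `ε`.
    (sub_pos.2 h)
  simpa using key

/-! ### Spins that move during a short time interval -/

theorem abs_magnetization_sub_le (n : ℕ) {σ τ : Config} {S : Set Site}
    (h : ∀ i ∉ S, σ i = τ i) :
    |magnetization n σ - magnetization n τ| ≤ 2 * boxAverage n (S.indicator 1) := by
  simp only [magnetization, boxAverage]
  rw [← mul_sub, ← Finset.sum_sub_distrib, abs_mul, abs_of_nonneg (by positivity),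
    mul_left_comm, Finset.mul_sum _ _ (2 : ℝ)]
  refine mul_le_mul_of_nonneg_left ((Finset.abs_sum_le_sum_abs _ _).trans
    (Finset.sum_le_sum fun i _ => ?_)) (by positivity)
  by_cases hi : i ∈ S
  · rcases Int.units_eq_one_or (σ i) with h1 | h1 <;>
      rcases Int.units_eq_one_or (τ i) with h2 | h2 <;> simp [h1, h2, hi] <;> norm_num
  · simp [h i hi, hi]

theorem measurable_magnetization (n : ℕ) : Measurable (magnetization n) := by
  unfold magnetization
  exact (Finset.measurable_fun_sum _ fun i _ =>
    (measurable_of_countable fun s : ℤˣ => ((s : ℤ) : ℝ)).comp (measurable_pi_apply i)).const_mul _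

theorem measurableSet_level (r : ℝ) : MeasurableSet (level r) :=
  measurableSet_tendsto _ measurable_magnetization

theorem measurable_eval_path (t : ℝ≥0) : Measurable fun γ : PathSpace => γ.1 t :=
  (measurable_pi_apply t).comp measurable_subtype_coe

/-- The paths whose spin at `i` differs, at some rational time closer than `δ` to `s`, from its
value at time `s`. -/
def movesNear (s : ℝ≥0) (δ : ℝ) (i : Site) : Set PathSpace :=
  {γ | ∃ q : ℚ, ∃ hq : 0 ≤ (q : ℝ), |(q : ℝ) - s| < δ ∧ γ.1 ⟨q, hq⟩ i ≠ γ.1 s i}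

theorem measurableSet_movesNear (s : ℝ≥0) (δ : ℝ) (i : Site) :
    MeasurableSet (movesNear s δ i) := by
  have : movesNear s δ i = ⋃ q : ℚ, ⋃ hq : 0 ≤ (q : ℝ), ⋃ _ : |(q : ℝ) - s| < δ,
      {γ | γ.1 ⟨q, hq⟩ i ≠ γ.1 s i} := by
    ext γ
    simp [movesNear]
  rw [this]
  have hm : ∀ t : ℝ≥0, Measurable fun γ : PathSpace => γ.1 t i := fun t =>
    (measurable_pi_apply i).comp (measurable_eval_path t)
  exact MeasurableSet.iUnion fun q => MeasurableSet.iUnion fun hq => MeasurableSet.iUnion fun _ =>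
    (measurableSet_eq_fun (hm _) (hm s)).compl

/-- Rational times keep `movesNear` measurable and lose nothing: spins are discrete and paths
right-continuous, so the value at `t` persists up to some rational time just after `t`, still inside
the window. -/
theorem eq_of_notMem_movesNear {s : ℝ≥0} {δ : ℝ} {i : Site} {γ : PathSpace}
    (hγ : γ ∉ movesNear s δ i) {t : ℝ≥0} (ht : |(t : ℝ) - s| < δ) : γ.1 t i = γ.1 s i := by
  by_contra hne
  have h1 : ∀ᶠ u in 𝓝[≥] t, γ.1 u i = γ.1 t i := by
    have := (tendsto_pi_nhds.1 (γ.2 t).1 i).eventually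
      (IsOpen.mem_nhds (isOpen_discrete {γ.1 t i}) rfl)
    exact this
  have h2 : ∀ᶠ u : ℝ≥0 in 𝓝[≥] t, |(u : ℝ) - s| < δ :=
    (((NNReal.continuous_coe.sub continuous_const).abs.tendsto t).eventually
      (gt_mem_nhds ht)).filter_mono nhdsWithin_le_nhds
  obtain ⟨b, hb, hsub⟩ := (mem_nhdsGE_iff_exists_Ico_subset (α := ℝ≥0)).1 (h1.and h2)
  obtain ⟨q, hq1, hq2⟩ := exists_rat_btwn (NNReal.coe_lt_coe.2 hb)
  have hq0 : 0 ≤ (q : ℝ) := t.2.trans hq1.le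
  have hq := hsub (show (⟨q, hq0⟩ : ℝ≥0) ∈ Set.Ico t b from
    ⟨NNReal.coe_le_coe.1 hq1.le, NNReal.coe_lt_coe.1 hq2⟩)
  exact hγ ⟨q, hq0, hq.2, fun h => hne (hq.1.symm.trans h)⟩

/-- Every ring lies outside the window, hence on the same side of `t` and of `s`. -/
theorem ringsUpTo_eq_of_notMem_ringsNear {ω : Noise} (hω : ω.IsRegular) {i : Site} {s δ t : ℝ}
    (h : siteNoise ω i ∉ ringsNear s δ) (ht : |t - s| < δ) :
    ringsUpTo ω i t = ringsUpTo ω i s := by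
  unfold ringsUpTo
  congr 1
  ext k
  have hk : δ ≤ |ringTime ω i k - s| := not_lt.1 fun hk => h ⟨(hω i).2, k, hk⟩
  have h1 := abs_lt.1 ht
  simp only [Set.mem_ofPred_eq]
  rcases le_abs'.1 hk with h2 | h2 <;> constructor <;> intro h3 <;> linarith

/-- This replaces dependent spin motions by independent clock events. The neighbours affect the
outcome of a ring but not whether it occurs; irregular noises give constant paths. -/
theorem siteNoise_mem_ringsNear_of_movesNear {β : ℝ} {ξ : Config} {ω : Noise} {s : ℝ≥0} {δ : ℝ}
    {i : Site} (h : graphicalPath β ξ ω ∈ movesNear s δ i) :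
    siteNoise ω i ∈ ringsNear s δ := by
  obtain ⟨q, hq, hqs, hne⟩ := h
  by_contra hnot
  refine hne ?_
  unfold graphicalPath
  split_ifs with hω
  · exact congrArg (spinAfter β ξ ω i) (ringsUpTo_eq_of_notMem_ringsNear hω hnot hqs)
  · rfl

/-- The sites whose spin moves at a rational time closer than `δ` to `s`. -/
def movingSites (s : ℝ≥0) (δ : ℝ) (γ : PathSpace) : Set Site := {i | γ ∈ movesNear s δ i}

theorem measurable_boxAverage_movingSites (s : ℝ≥0) (δ : ℝ) (n : ℕ) :
    Measurable fun γ => boxAverage n ((movingSites s δ γ).indicator 1) := by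
  unfold boxAverage
  refine (Finset.measurable_fun_sum _ fun i _ => ?_).const_mul _
  exact (measurable_one (α := ℝ)).indicator (measurableSet_movesNear s δ i)

theorem ae_eventually_boxAverage_movingSites_lt (β : ℝ) (ξ : Config) {s : ℝ≥0} {δ ε : ℝ}
    (h : siteNoiseMeasure.real (ringsNear s δ) < ε) :
    ∀ᵐ γ ∂(pathLaw β ξ), ∀ᶠ n in atTop,
      boxAverage n ((movingSites s δ γ).indicator 1) < ε := by
  unfold pathLaw
  have hm : MeasurableSet {γ : PathSpace | ∀ᶠ n in atTop,
      boxAverage n ((movingSites s δ γ).indicator 1) < ε} := by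
    have : {γ : PathSpace | ∀ᶠ n in atTop,
        boxAverage n ((movingSites s δ γ).indicator 1) < ε} = ⋃ N : ℕ, ⋂ n : ℕ, ⋂ _ : N ≤ n,
          {γ | boxAverage n ((movingSites s δ γ).indicator 1) < ε} := by
      ext γ
      simp [eventually_atTop]
    rw [this]
    exact MeasurableSet.iUnion fun N => MeasurableSet.iInter fun n => MeasurableSet.iInter fun _ =>
      measurableSet_lt (measurable_boxAverage_movingSites s δ n) measurable_const
  rw [ae_map_iff (measurable_graphicalPath β ξ).aemeasurable hm]
  filter_upwards [ae_eventually_boxAverage_ringsNear_lt h] with ω hω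
  filter_upwards [hω] with n hn
  refine (boxAverage_mono n fun i => ?_).trans_lt hn
  by_cases hi : i ∈ movingSites s δ (graphicalPath β ξ ω)
  · rw [Set.indicator_of_mem hi, Set.indicator_of_mem (siteNoise_mem_ringsNear_of_movesNear hi)]
    simp
  · rw [Set.indicator_of_notMem hi]
    exact Set.indicator_nonneg (fun _ _ => zero_le_one) _

/-! ### From fixed times to all times. -/

theorem ae_mem_of_mem_fixedTimeConfined {β : ℝ} {C : Set Config} (hC : MeasurableSet C)
    {ξ : Config} (hξ : ξ ∈ fixedTimeConfined β C) (t : ℝ≥0) :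
    ∀ᵐ γ ∂(pathLaw β ξ), γ.1 t ∈ C := by
  have h := hξ.2 t
  rw [transition, Measure.map_apply (measurable_eval_path t) hC] at h
  exact (prob_compl_eq_zero_iff (measurable_eval_path t hC)).2 h

/-- The half-width depends on the centre; the Lindelöf property of `ℝ≥0` extracts countably many
windows. -/
theorem exists_countable_cover_ringsNear_lt (ε : ℝ) (hε : 0 < ε) :
    ∃ δ : ℝ≥0 → ℝ, ∃ S : Set ℝ≥0, S.Countable ∧
    (∀ s : ℝ≥0, siteNoiseMeasure.real (ringsNear s (δ s)) < ε) ∧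
    ∀ t : ℝ≥0, ∃ s ∈ S, |(t : ℝ) - s| < δ s := by
  choose δ hδ hlt using fun s : ℝ≥0 => exists_siteNoiseMeasure_ringsNear_lt (s : ℝ) hε
  obtain ⟨S, hS, hcov⟩ := TopologicalSpace.countable_cover_nhds fun s : ℝ≥0 =>
    Metric.ball_mem_nhds s (hδ s)
  refine ⟨δ, S, hS, hlt, fun t => ?_⟩
  have ht : t ∈ ⋃ s ∈ S, Metric.ball s (δ s) := hcov ▸ Set.mem_univ t
  simpa [NNReal.dist_eq] using ht

theorem mainTheorem6 (β : ℝ) (r : ℝ) (hr : r ∈ Set.Icc (-1 : ℝ) 1) :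
    fixedTimeConfined β (level r) ⊆ pathwiseConfined β (level r) := by
  intro ξ hξ
  refine ⟨hξ.1, ?_⟩
  choose δ S hS hlt hcov using fun q : ℕ =>
    exists_countable_cover_ringsNear_lt (1 / ((q : ℝ) + 1)) (by positivity)
  -- Only countably many pairs `(q, s)` occur, so the exceptional set is chosen before `t`.
  have hgood : ∀ᵐ γ ∂(pathLaw β ξ), ∀ q, ∀ s ∈ S q, γ.1 s ∈ level r ∧ ∀ᶠ n in atTop,
      boxAverage n ((movingSites s (δ q s) γ).indicator 1) < 1 / ((q : ℝ) + 1) := by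
    refine ae_all_iff.2 fun q => (ae_ball_iff (hS q)).2 fun s _ => ?_
    exact (ae_mem_of_mem_fixedTimeConfined (measurableSet_level r) hξ s).and
      (ae_eventually_boxAverage_movingSites_lt β ξ (hlt q s))
  filter_upwards [hgood] with γ hγ t
  refine Metric.tendsto_atTop'.2 fun ε hε => ?_
  -- One third of `ε` is for convergence at the centre `s`; two thirds are for the moving sites,
  -- since a flip changes a spin by `2`.
  obtain ⟨q, hq⟩ := exists_nat_one_div_lt (show 0 < ε / 3 by positivity)
  obtain ⟨s, hs, hts⟩ := hcov q t
  obtain ⟨hlev, hmov⟩ := hγ q s hs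
  have hev := (Metric.tendsto_nhds.1 hlev (ε / 3) (by positivity)).and hmov
  obtain ⟨N, hN⟩ := eventually_atTop.1 hev
  refine ⟨N, fun n hn => ?_⟩
  obtain ⟨h1, h2⟩ := hN n hn.le
  have h3 := abs_magnetization_sub_le n (σ := γ.1 t) (τ := γ.1 s)
    (S := movingSites s (δ q s) γ) fun i hi => eq_of_notMem_movesNear hi hts
  rw [Real.dist_eq] at h1 ⊢
  have h4 := abs_sub_le (magnetization n (γ.1 t)) (magnetization n (γ.1 s)) r
  linarith
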